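/- Let $\Gamma$ be a finite simplicial graph (undirected, no loops, no multiple edges) with a nonempty vertex set $V(\Gamma)$ and $|V(\Gamma)|\neq 2$, and let $F$ be a field. Let \[A(\Gamma)=\langle V(\Gamma)\mid [v,w]=1 \text{ whenever } \{v,w\}\in E(\Gamma)\rangle\] be the right-angled Artin group on $\Gamma$, and let $(V,W,q)$ be the triple with $V=H^1(A(\Gamma),F)$, $W=H^2(A(\Gamma),F)$ (group cohomology with trivial coefficients) and $q=\cup\colon V\times V\to W$ the cup product. Then $\Gamma$ has a Hamiltonian cycle (a closed cycle, of length at least three, that visits every vertex exactly once) if and only if $(V,W,q)$ is Hamiltonian, that is: $V$ is finite dimensional and for every basis $\{v_0,\ldots,v_n\}$ of $V$ there is a permutation $\sigma$ of $\{0,\ldots,n\}$ such that $q(v_{\sigma(i)},v_{\sigma(i+1)})\neq 0$ for all $i$, where indices are taken cyclically modulo $n+1$. -/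

import Mathlib

universe u

/-- The right-angled Artin group of a graph: one generator for each vertex, and the generators of
any two adjacent vertices commute. -/
abbrev RightAngledArtinGroup {V : Type*} (Γ : SimpleGraph V) : Type _ :=
  PresentedGroup {r : FreeGroup V | ∃ u v : V, Γ.Adj u v ∧
    r = FreeGroup.of u * FreeGroup.of v * (FreeGroup.of u)⁻¹ * (FreeGroup.of v)⁻¹}

noncomputable section CupProduct

/-- The group cohomology `H¹(G, k)` with trivial coefficients. -/
abbrev trivialH1 (k G : Type u) [CommRing k] [Group G] : Type u :=
  groupCohomology.H1 (Rep.trivial k G k)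

/-- The group cohomology `H²(G, k)` with trivial coefficients. -/
abbrev trivialH2 (k G : Type u) [CommRing k] [Group G] : Type u :=
  groupCohomology.H2 (Rep.trivial k G k)

/-- The cup product of two inhomogeneous `1`-cocycles with trivial coefficients:
the `2`-cocycle `(x, y) ↦ a x * b y`. -/
def cupCocycle {k G : Type u} [CommRing k] [Group G]
    (a b : groupCohomology.cocycles₁ (Rep.trivial k G k)) :
    groupCohomology.cocycles₂ (Rep.trivial k G k) :=
  ⟨fun p : G × G => (a p.1 * b p.2 : k), by
    rw [groupCohomology.mem_cocycles₂_iff]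
    intro g h j
    have ha : (a (g * h) : k) = a g + a h :=
      groupCohomology.cocycles₁_map_mul_of_isTrivial a g h
    have hb : (b (h * j) : k) = b h + b j :=
      groupCohomology.cocycles₁_map_mul_of_isTrivial b h j
    change (a (g * h) * b j + a g * b h : k) = a h * b j + a g * b (h * j)
    rw [ha, hb]
    ring⟩

/-- The cup product of cocycles as a bilinear map into `H²`. -/
def cupOnCocycles (k G : Type u) [CommRing k] [Group G] :
    groupCohomology.cocycles₁ (Rep.trivial k G k) →ₗ[k]
      groupCohomology.cocycles₁ (Rep.trivial k G k) →ₗ[k] trivialH2 k G :=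
  LinearMap.mk₂ k
    (fun a b => (groupCohomology.H2π (Rep.trivial k G k)).hom (cupCocycle a b))
    (fun a a' b => by
      rw [← map_add]
      exact congrArg _ (Subtype.ext (funext fun p => add_mul (a p.1 : k) (a' p.1) (b p.2))))
    (fun c a b => by
      rw [← map_smul]
      exact congrArg _ (Subtype.ext (funext fun p => mul_assoc (c : k) (a p.1) (b p.2))))
    (fun a b b' => by
      rw [← map_add]
      exact congrArg _ (Subtype.ext (funext fun p => mul_add (a p.1 : k) (b p.2) (b' p.2))))
    (fun c a b => by
      rw [← map_smul]
      exact congrArg _ (Subtype.ext (funext fun p => mul_left_comm (a p.1 : k) c (b p.2))))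

/-- The quotient map from `1`-cocycles to `H¹`, inverted: with trivial coefficients every
`1`-coboundary vanishes, so each class is represented by exactly one cocycle. -/
def H1Cocycle (k G : Type u) [CommRing k] [Group G] :
    trivialH1 k G ≃ₗ[k] groupCohomology.cocycles₁ (Rep.trivial k G k) :=
  (groupCohomology.H1IsoOfIsTrivial (Rep.trivial k G k) ≪≫
    (groupCohomology.cocycles₁IsoOfIsTrivial (Rep.trivial k G k)).symm).toLinearEquiv

/-- The cup product `H¹(G, k) × H¹(G, k) → H²(G, k)`. -/
def cupProduct (k G : Type u) [CommRing k] [Group G] :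
    trivialH1 k G →ₗ[k] trivialH1 k G →ₗ[k] trivialH2 k G :=
  (cupOnCocycles k G).compl₁₂ (H1Cocycle k G).toLinearMap (H1Cocycle k G).toLinearMap

theorem H1Cocycle_H1π {k G : Type u} [CommRing k] [Group G]
    (a : groupCohomology.cocycles₁ (Rep.trivial k G k)) :
    H1Cocycle k G ((groupCohomology.H1π (Rep.trivial k G k)).hom a) = a := by
  apply groupCohomology.cocycles₁_ext
  intro g
  exact groupCohomology.H1IsoOfIsTrivial_H1π_apply_apply a (Additive.ofMul g)

/-- The cup product of the classes of two cocycles is the class of the product cocycle. -/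
theorem cupProduct_H1π {k G : Type u} [CommRing k] [Group G]
    (a b : groupCohomology.cocycles₁ (Rep.trivial k G k)) :
    cupProduct k G ((groupCohomology.H1π (Rep.trivial k G k)).hom a)
        ((groupCohomology.H1π (Rep.trivial k G k)).hom b) =
      (groupCohomology.H2π (Rep.trivial k G k)).hom (cupCocycle a b) :=
  congrArg₂ (fun x y => cupOnCocycles k G x y) (H1Cocycle_H1π a) (H1Cocycle_H1π b)

end CupProduct

/-- A triple `(M, W, q)` of a finite-dimensional vector space `M`, a vector space `W` and a
bilinear pairing `q : M × M → W` is Hamiltonian if every basis `b₀, …, bₙ` of `M` can be reordered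
so that `q` is nonzero on any two cyclically consecutive vectors. The addition `i + 1` in
`Fin (n + 1)` is cyclic. -/
def IsHamiltonianTriple {F M W : Type*} [Field F] [AddCommGroup M] [Module F M]
    [AddCommGroup W] [Module F W] (q : M →ₗ[F] M →ₗ[F] W) : Prop :=
  Module.Finite F M ∧
    ∀ (n : ℕ) (b : Module.Basis (Fin (n + 1)) F M),
      ∃ σ : Equiv.Perm (Fin (n + 1)), ∀ i : Fin (n + 1), q (b (σ i)) (b (σ (i + 1))) ≠ 0

/-! A class in `H¹` is a vector in `F^V`, its values on the generators, and a cup product vanishes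
exactly when the `2 × 2` minors of the two vectors on all edges vanish
(`H2π_cupCocycle_eq_zero_iff`). The standard basis then recovers adjacency, so the Hamiltonian
property yields a cycle. Conversely, a basis is an invertible matrix, and a cycle carries over to it
through a matching of rows with vertices (`exists_perm_not_edgeProportional`). A nonzero Leibniz
term alone is not enough: two independent rows may be proportional on every edge. Rows are therefore
first split along the components of their supports, where edge proportionality becomes genuine
proportionality. -/

namespace SimpleGraph

variable {V F : Type*} [Field F] (Γ : SimpleGraph V)

/-- The edges of `Γ` both of whose endpoints lie in the support of `a`. -/
def supportGraph (a : V → F) : SimpleGraph V where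
  Adj u v := Γ.Adj u v ∧ a u ≠ 0 ∧ a v ≠ 0
  symm := ⟨fun _ _ h => ⟨h.1.symm, h.2.2, h.2.1⟩⟩
  loopless := ⟨fun _ h => h.1.ne rfl⟩

/-- All `2 × 2` minors of the two rows `a` and `b` on columns joined by an edge vanish. -/
def EdgeProportional (a b : V → F) : Prop :=
  ∀ u v, Γ.Adj u v → a u * b v = a v * b u

variable {Γ}

theorem EdgeProportional.symm {a b : V → F} (h : Γ.EdgeProportional a b) :
    Γ.EdgeProportional b a := fun u v huv => by
  rw [mul_comm, ← h u v huv, mul_comm]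

/-- On an edge of the support of `a`, vanishing of the minor carries nonvanishing of `b` from one
end to the other, so the ratio `b / a` stays constant along a path. -/
theorem EdgeProportional.of_reachable {a b : V → F} (h : Γ.EdgeProportional a b) {u v : V}
    (huv : (Γ.supportGraph a).Reachable u v) (hau : a u ≠ 0) (hbu : b u ≠ 0) :
    (Γ.supportGraph b).Reachable u v ∧ a v ≠ 0 ∧ b v ≠ 0 ∧ a u * b v = a v * b u := by
  obtain ⟨p⟩ := huv
  induction p with
  | nil => exact ⟨.refl _, hau, hbu, rfl⟩
  | @cons u x v hux p ih =>
    have hx := h u x hux.1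
    have hbx : b x ≠ 0 := fun h0 => by
      rw [h0, mul_zero] at hx
      exact mul_ne_zero hux.2.2 hbu hx.symm
    obtain ⟨hr, hav, hbv, hm⟩ := ih hux.2.2 hbx
    refine ⟨(Adj.reachable (⟨hux.1, hbu, hbx⟩ : (Γ.supportGraph b).Adj u x)).trans hr,
      hav, hbv, ?_⟩
    apply mul_left_cancel₀ hux.2.2
    linear_combination a u * hm + a v * hx

open Classical in
/-- The restriction of `a` to a connected component of its support graph. -/
noncomputable def componentPart (a : V → F) (c : (Γ.supportGraph a).ConnectedComponent) :
    V → F :=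
  fun v => if (Γ.supportGraph a).connectedComponentMk v = c then a v else 0

theorem sum_componentPart [Fintype V] (a : V → F)
    [Fintype (Γ.supportGraph a).ConnectedComponent] :
    ∑ c : (Γ.supportGraph a).ConnectedComponent, componentPart a c = a := by
  classical
  ext v
  simp [componentPart, Finset.sum_apply]

/-- The minor on `u v` makes all four entries nonzero, so `c` and `d` have the same vertex set, on
which `b / a` is constant. -/
theorem EdgeProportional.componentPart_eq_smul {a b : V → F} (h : Γ.EdgeProportional a b)
    {u v : V} (huv : Γ.Adj u v)
    {c : (Γ.supportGraph a).ConnectedComponent} {d : (Γ.supportGraph b).ConnectedComponent}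
    (hc : componentPart a c u ≠ 0) (hd : componentPart b d v ≠ 0) :
    a u • componentPart b d = b u • componentPart a c := by
  classical
  simp only [componentPart, ne_eq, ite_eq_right_iff, Classical.not_imp] at hc hd
  obtain ⟨rfl, hau⟩ := hc
  obtain ⟨rfl, hbv⟩ := hd
  have huv' := h u v huv
  have hne : a v * b u ≠ 0 := huv' ▸ mul_ne_zero hau hbv
  have hbu : b u ≠ 0 := right_ne_zero_of_mul hne
  have hadj : (Γ.supportGraph b).Reachable u v :=
    Adj.reachable (⟨huv, hbu, hbv⟩ : (Γ.supportGraph b).Adj u v)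
  ext x
  simp only [Pi.smul_apply, componentPart, ConnectedComponent.eq, smul_eq_mul]
  by_cases hx : (Γ.supportGraph a).Reachable u x
  · obtain ⟨hr, -, -, hm⟩ := h.of_reachable hx hau hbu
    rw [if_pos (hr.symm.trans hadj), if_pos hx.symm, hm, mul_comm]
  · rw [if_neg, if_neg fun hx' => hx hx'.symm, mul_zero, mul_zero]
    intro hx'
    exact hx (h.symm.of_reachable (hadj.trans hx'.symm) hbu hau).1

/-- The columns of an invertible matrix indexed by the vertices of a graph can be matched with its
rows so that rows matched with adjacent columns have a nonzero `2 × 2` minor on some edge. -/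
theorem exists_perm_not_edgeProportional [Fintype V] [DecidableEq V] (A : V → V → F)
    (hA : (Matrix.of A).det ≠ 0) :
    ∃ σ : Equiv.Perm V, ∀ u v, Γ.Adj u v → ¬ Γ.EdgeProportional (A (σ u)) (A (σ v)) := by
  classical
  have hsum : (Matrix.of A).det = ∑ f : ∀ i, (Γ.supportGraph (A i)).ConnectedComponent,
      (Matrix.of fun i => componentPart (A i) (f i)).det := by
    -- The determinant is multilinear in the rows, each the sum of its component parts.
    refine Eq.trans ?_ ((Matrix.detRowAlternating (R := F) (n := V)).toMultilinearMap.map_sum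
      (fun i (c : (Γ.supportGraph (A i)).ConnectedComponent) => componentPart (A i) c))
    simp only [sum_componentPart]
    rfl
  rw [hsum] at hA
  obtain ⟨f, -, hf⟩ := Finset.exists_ne_zero_of_sum_ne_zero hA
  have hdet := hf
  rw [Matrix.det_apply] at hf
  obtain ⟨σ, -, hσ⟩ := Finset.exists_ne_zero_of_sum_ne_zero hf
  simp only [Matrix.of_apply] at hσ
  have hprod : ∀ i, componentPart (A (σ i)) (f (σ i)) i ≠ 0 := fun i =>
    Finset.prod_ne_zero_iff.1 (right_ne_zero_of_smul hσ) i (Finset.mem_univ i)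
  refine ⟨σ, fun u v huv h => ?_⟩
  have hsm := h.componentPart_eq_smul huv (hprod u) (hprod v)
  have hau : A (σ u) u ≠ 0 := fun h0 => hprod u (by simp [componentPart, h0])
  have hli : LinearIndependent F (fun i => componentPart (A i) (f i)) :=
    Matrix.linearIndependent_rows_of_det_ne_zero hdet
  have hpair : LinearIndependent F
      ![componentPart (A (σ u)) (f (σ u)), componentPart (A (σ v)) (f (σ v))] := by
    convert hli.comp ![σ u, σ v] (by simpa [Function.Injective, Fin.forall_fin_two] using
      ⟨huv.ne, huv.ne'⟩) using 1
    ext i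
    fin_cases i <;> rfl
  -- Proportional component parts would be two dependent rows of the matrix with nonzero
  -- determinant.
  exact hau (LinearIndependent.pair_iff.1 hpair (-(A (σ v) u)) (A (σ u) u)
    (by rw [hsm, neg_smul, neg_add_cancel])).2

theorem exists_isHamiltonianCycle_iff [Fintype V] [DecidableEq V] {n : ℕ}
    (hn : Fintype.card V = n + 3) :
    (∃ (v : V) (p : Γ.Walk v v), p.IsHamiltonianCycle) ↔
      ∃ w : Fin (n + 3) ≃ V, ∀ i, Γ.Adj (w i) (w (i + 1)) := by
  simp only [Walk.isHamiltonianCycle_iff_isCycle_and_length_eq, hn]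
  rw [← cycleGraph_isContained_iff (by omega)]
  constructor
  · rintro ⟨f⟩
    refine ⟨Equiv.ofBijective f ((Fintype.bijective_iff_injective_and_card _).2
      ⟨f.injective, by simp [hn]⟩), fun i => ?_⟩
    exact f.toHom.map_adj (by rw [cycleGraph_adj]; simp)
  · rintro ⟨w, hw⟩
    refine ⟨⟨⟨w, fun {i j} hij => ?_⟩, w.injective⟩⟩
    rw [cycleGraph_adj] at hij
    rcases hij with h | h
    · obtain rfl := sub_eq_iff_eq_add'.1 h; exact (hw j).symm
    · obtain rfl := sub_eq_iff_eq_add'.1 h; exact hw i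

theorem not_exists_isHamiltonianCycle_of_card_eq_one [Fintype V] [DecidableEq V]
    (hV : Fintype.card V = 1) : ¬ ∃ (v : V) (p : Γ.Walk v v), p.IsHamiltonianCycle := by
  rintro ⟨v, p, hp⟩
  have := hp.three_le_length
  have := hp.length_eq
  omega

end SimpleGraph

/-! ### Hamiltonian cycles and pairings -/

section HamiltonianTriple

variable {V F M W : Type*} [Fintype V] [DecidableEq V] [Field F] [AddCommGroup M] [Module F M]
  [AddCommGroup W] [Module F W] {Γ : SimpleGraph V}

/-- For a pairing that vanishes exactly on the pairs of vectors whose minors along all edges of `Γ`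
vanish, being Hamiltonian means that `Γ` has a Hamiltonian cycle. -/
theorem exists_isHamiltonianCycle_iff_isHamiltonianTriple [Nonempty V] (hV : Fintype.card V ≠ 2)
    (q : M →ₗ[F] M →ₗ[F] W) (E : M ≃ₗ[F] (V → F))
    (hq : ∀ a b, q a b = 0 ↔ Γ.EdgeProportional (E a) (E b)) :
    (∃ (v : V) (p : Γ.Walk v v), p.IsHamiltonianCycle) ↔ IsHamiltonianTriple q := by
  have hfin : Module.Finite F M := Module.Finite.equiv E.symm
  have hrank : Module.finrank F M = Fintype.card V := by
    rw [E.finrank_eq, Module.finrank_fintype_fun_eq_card]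
  have hpos : 0 < Fintype.card V := Fintype.card_pos
  obtain h1 | ⟨n, hn⟩ : Fintype.card V = 1 ∨ ∃ n, Fintype.card V = n + 3 := by
    rcases h : Fintype.card V with _ | _ | _ | n
    · omega
    · exact .inl rfl
    · omega
    · exact .inr ⟨n, rfl⟩
  -- With one vertex there are no edges, so `q` is zero, while the cyclic condition asks for `q (b
  -- 0) (b 0) ≠ 0`.
  · refine iff_of_false (SimpleGraph.not_exists_isHamiltonianCycle_of_card_eq_one h1) ?_
    rintro ⟨-, h⟩
    obtain ⟨σ, hσ⟩ := h 0 (Module.finBasisOfFinrankEq F M (hrank.trans h1))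
    refine hσ 0 ((hq _ _).2 fun u v huv => ?_)
    have : Subsingleton V := Fintype.card_le_one_iff_subsingleton.1 h1.le
    exact absurd (Subsingleton.elim u v) huv.ne
  rw [SimpleGraph.exists_isHamiltonianCycle_iff hn]
  constructor
  · rintro ⟨w, hw⟩
    refine ⟨hfin, fun m b => ?_⟩
    obtain rfl : m = n + 2 := by
      have := Module.finrank_eq_card_basis b
      rw [hrank, hn, Fintype.card_fin] at this
      omega
    have hli : LinearIndependent F (fun v => E (b (w.symm v))) :=
      (b.linearIndependent.map' E.toLinearMap E.ker).comp _ w.symm.injective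
    have hdet : (Matrix.of fun v => E (b (w.symm v))).det ≠ 0 :=
      ((Matrix.isUnit_iff_isUnit_det _).1
        (Matrix.linearIndependent_rows_iff_isUnit.1 hli)).ne_zero
    obtain ⟨σ, hσ⟩ := SimpleGraph.exists_perm_not_edgeProportional (Γ := Γ) _ hdet
    -- Position `i` on the cycle receives the basis vector whose row is matched with the vertex `w
    -- i`.
    refine ⟨(w.trans σ).trans w.symm, fun i h0 => hσ _ _ (hw i) ((hq _ _).1 h0)⟩
  · rintro ⟨-, h⟩
    let e : V ≃ Fin (n + 3) := Fintype.equivFinOfCardEq hn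
    let b : Module.Basis (Fin (n + 2 + 1)) F M := (Module.Basis.ofEquivFun E).reindex e
    have hb : ∀ i, E (b i) = Pi.single (e.symm i) 1 := fun i => by
      simp [b, Module.Basis.coe_ofEquivFun]
    obtain ⟨σ, hσ⟩ := h _ b
    refine ⟨σ.trans e.symm, fun i => ?_⟩
    by_contra hadj
    refine hσ i ((hq _ _).2 fun u v huv => ?_)
    rw [hb, hb]
    simp only [Equiv.trans_apply] at hadj
    simp only [Pi.single_apply]
    have := huv.symm
    split_ifs <;> simp_all

end HamiltonianTriple

/-! ### Cup products and the Heisenberg group -/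

/-- The Heisenberg group over a commutative ring: upper unitriangular `3 × 3` matrices with entries
`x`, `y` above the diagonal and `z` in the corner. -/
@[ext]
structure HeisenbergGroup (R : Type*) where
  /-- The entry in position `(1, 2)`. -/
  x : R
  /-- The entry in position `(2, 3)`. -/
  y : R
  /-- The entry in position `(1, 3)`. -/
  z : R

namespace HeisenbergGroup

variable {R : Type*} [CommRing R]

instance : Mul (HeisenbergGroup R) := ⟨fun g h => ⟨g.x + h.x, g.y + h.y, g.z + h.z + g.x * h.y⟩⟩

instance : One (HeisenbergGroup R) := ⟨⟨0, 0, 0⟩⟩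

instance : Inv (HeisenbergGroup R) := ⟨fun g => ⟨-g.x, -g.y, -g.z + g.x * g.y⟩⟩

@[simp] theorem mul_x (g h : HeisenbergGroup R) : (g * h).x = g.x + h.x := rfl

@[simp] theorem mul_y (g h : HeisenbergGroup R) : (g * h).y = g.y + h.y := rfl

@[simp] theorem mul_z (g h : HeisenbergGroup R) : (g * h).z = g.z + h.z + g.x * h.y := rfl

@[simp] theorem one_x : (1 : HeisenbergGroup R).x = 0 := rfl

@[simp] theorem one_y : (1 : HeisenbergGroup R).y = 0 := rfl

@[simp] theorem one_z : (1 : HeisenbergGroup R).z = 0 := rfl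

@[simp] theorem inv_x (g : HeisenbergGroup R) : g⁻¹.x = -g.x := rfl

@[simp] theorem inv_y (g : HeisenbergGroup R) : g⁻¹.y = -g.y := rfl

@[simp] theorem inv_z (g : HeisenbergGroup R) : g⁻¹.z = -g.z + g.x * g.y := rfl

instance : Group (HeisenbergGroup R) :=
  Group.ofLeftAxioms
    (fun a b c => by ext <;> simp <;> ring)
    (fun a => by ext <;> simp)
    (fun a => by ext <;> simp)

/-- The corner entries of `g * h` and `h * g` differ by exactly this minor. -/
theorem mul_comm_of_mul_eq {g h : HeisenbergGroup R} (hgh : g.x * h.y = h.x * g.y) :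
    g * h = h * g := by
  ext
  · exact add_comm _ _
  · exact add_comm _ _
  · simp only [mul_z, hgh, add_comm g.z]

end HeisenbergGroup

namespace RightAngledArtinGroup

section Lift

variable {V G : Type*} [Group G] {Γ : SimpleGraph V}

/-- The standard generator at a vertex. -/
abbrev of (v : V) : RightAngledArtinGroup Γ := PresentedGroup.of v

theorem of_mul_of {u v : V} (huv : Γ.Adj u v) :
    (of u * of v : RightAngledArtinGroup Γ) = of v * of u := by
  have h := PresentedGroup.one_of_mem
    (rels := {r : FreeGroup V | ∃ u v : V, Γ.Adj u v ∧
      r = FreeGroup.of u * FreeGroup.of v * (FreeGroup.of u)⁻¹ * (FreeGroup.of v)⁻¹})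
    ⟨u, v, huv, rfl⟩
  simp only [map_mul, map_inv] at h
  exact mul_inv_eq_iff_eq_mul.1 (mul_inv_eq_one.1 h)

/-- A map on vertices that sends adjacent vertices to commuting elements extends to a homomorphism
from the right-angled Artin group. -/
def lift (f : V → G) (hf : ∀ u v, Γ.Adj u v → f u * f v = f v * f u) :
    RightAngledArtinGroup Γ →* G :=
  PresentedGroup.toGroup (f := f) (by
    rintro _ ⟨u, v, huv, rfl⟩
    simp [hf u v huv])

@[simp]
theorem lift_of (f : V → G) (hf : ∀ u v, Γ.Adj u v → f u * f v = f v * f u) (v : V) :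
    lift f hf (of v) = f v :=
  PresentedGroup.toGroup.of _

end Lift

section Cohomology

variable {V k : Type u} [CommRing k] (Γ : SimpleGraph V)

theorem cocycle_eq_of_hom (a : groupCohomology.cocycles₁ (Rep.trivial k (RightAngledArtinGroup Γ) k))
    (φ : RightAngledArtinGroup Γ →* Multiplicative k)
    (h : ∀ v, Multiplicative.toAdd (φ (of v)) = a (of v)) (g : RightAngledArtinGroup Γ) :
    Multiplicative.toAdd (φ g) = a g := by
  let ψ : RightAngledArtinGroup Γ →* Multiplicative k :=
    { toFun := fun g => Multiplicative.ofAdd (a g : k)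
      map_one' := congrArg _ (groupCohomology.cocycles₁_map_one a)
      map_mul' := fun g h =>
        congrArg _ (groupCohomology.cocycles₁_map_mul_of_isTrivial a g h) }
  have : φ = ψ := PresentedGroup.ext fun v => h v
  rw [this]
  rfl

/-- A `1`-cocycle on a right-angled Artin group is determined by its values on the generators, which
can be prescribed arbitrarily. -/
noncomputable def cocyclesEquiv :
    groupCohomology.cocycles₁ (Rep.trivial k (RightAngledArtinGroup Γ) k) ≃ₗ[k] (V → k) where
  toFun a v := a (of v)
  map_add' _ _ := rfl
  map_smul' _ _ := rfl
  invFun f := ⟨fun g => Multiplicative.toAdd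
      (lift (Γ := Γ) (fun v => Multiplicative.ofAdd (f v)) (fun _ _ _ => mul_comm _ _) g), by
    rw [groupCohomology.mem_cocycles₁_iff]
    intro g h
    rw [map_mul, mul_comm]
    rfl⟩
  left_inv a := groupCohomology.cocycles₁_ext fun g =>
    cocycle_eq_of_hom Γ a _ (fun v => congrArg _ (lift_of _ _ v)) g
  right_inv f := funext fun v => congrArg Multiplicative.toAdd (lift_of _ _ v)

theorem mem_coboundaries₂_trivial_iff {G : Type u} [Group G] (f : G × G → k) :
    f ∈ groupCohomology.coboundaries₂ (Rep.trivial k G k) ↔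
      ∃ c : G → k, ∀ g h, f (g, h) = c h - c (g * h) + c g := by
  constructor
  · rintro ⟨c, rfl⟩
    exact ⟨c, fun g h => rfl⟩
  · rintro ⟨c, hc⟩
    exact ⟨c, funext fun p => (hc p.1 p.2).symm⟩

/-- A cobounding function gives an expression symmetric in commuting elements, which kills the
minors. Conversely, vanishing minors let `a` and `b` lift together to the Heisenberg group. -/
theorem H2π_cupCocycle_eq_zero_iff
    (a b : groupCohomology.cocycles₁ (Rep.trivial k (RightAngledArtinGroup Γ) k)) :
    (groupCohomology.H2π _).hom (cupCocycle a b) = 0 ↔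
      ∀ u v, Γ.Adj u v → (a (of u) * b (of v) : k) = a (of v) * b (of u) := by
  refine (groupCohomology.H2π_eq_zero_iff _).trans
    ((mem_coboundaries₂_trivial_iff (fun p => (a p.1 * b p.2 : k))).trans ⟨?_, fun h => ?_⟩)
  · rintro ⟨c, hc⟩ u v huv
    have huv' : (c (of u * of v) : k) = c (of v * of u) := congrArg c (of_mul_of huv)
    have huc : (a (of u) * b (of v) : k) = c (of v) - c (of u * of v) + c (of u) := hc _ _
    have hvc : (a (of v) * b (of u) : k) = c (of u) - c (of v * of u) + c (of v) := hc _ _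
    rw [huc, hvc, huv']
    ring
  · let φ : RightAngledArtinGroup Γ →* HeisenbergGroup k :=
      lift (fun v => ⟨a (of v), b (of v), 0⟩)
        fun u v huv => HeisenbergGroup.mul_comm_of_mul_eq (h u v huv)
    have hx : ∀ g, (φ g).x = a g :=
      cocycle_eq_of_hom Γ a
        { toFun := fun g => Multiplicative.ofAdd (φ g).x
          map_one' := by rw [map_one]; rfl
          map_mul' := fun g h => by rw [map_mul]; rfl }
        fun v => congrArg HeisenbergGroup.x (lift_of _ _ v)
    have hy : ∀ g, (φ g).y = b g :=
      cocycle_eq_of_hom Γ b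
        { toFun := fun g => Multiplicative.ofAdd (φ g).y
          map_one' := by rw [map_one]; rfl
          map_mul' := fun g h => by rw [map_mul]; rfl }
        fun v => congrArg HeisenbergGroup.y (lift_of _ _ v)
    -- The corner entry fails to be additive by precisely `a g * b h`; the sign matches the
    -- coboundary convention.
    refine ⟨fun g => -(φ g).z, fun g h => ?_⟩
    change (a g * b h : k) = -(φ h).z - -(φ (g * h)).z + -(φ g).z
    rw [map_mul, HeisenbergGroup.mul_z, hx, hy]
    ring

/-- The first cohomology of a right-angled Artin group has coordinates indexed by the vertices. -/
noncomputable def H1Equiv : trivialH1 k (RightAngledArtinGroup Γ) ≃ₗ[k] (V → k) :=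
  (H1Cocycle k (RightAngledArtinGroup Γ)).trans (cocyclesEquiv Γ)

end Cohomology

theorem cupProduct_eq_zero_iff {V F : Type u} [Field F] (Γ : SimpleGraph V)
    (a b : trivialH1 F (RightAngledArtinGroup Γ)) :
    cupProduct F (RightAngledArtinGroup Γ) a b = 0 ↔
      Γ.EdgeProportional (H1Equiv Γ a) (H1Equiv Γ b) :=
  H2π_cupCocycle_eq_zero_iff Γ _ _

end RightAngledArtinGroup

theorem theorem3 {V F : Type u} [Fintype V] [DecidableEq V] [Nonempty V] [Field F]
    (Γ : SimpleGraph V) (hV : Fintype.card V ≠ 2) :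
    (∃ (v : V) (p : Γ.Walk v v), p.IsHamiltonianCycle) ↔
      IsHamiltonianTriple (cupProduct F (RightAngledArtinGroup Γ)) :=
  exists_isHamiltonianCycle_iff_isHamiltonianTriple hV _ (RightAngledArtinGroup.H1Equiv Γ)
    (RightAngledArtinGroup.cupProduct_eq_zero_iff Γ)
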